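/- Let $p\ge 1$, $V=\{1,\dots,p\}$, let $\Omega^*$ be a symmetric positive definite real $p\times p$ matrix, and let $x=(x_1,\dots,x_p)\sim N_p(0,(\Omega^*)^{-1})$. Let $G^*=(V,E^*)$ be the undirected graph in which two distinct nodes $i,j$ are non-adjacent if and only if $x_i$ and $x_j$ are conditionally independent given the remaining components $x_{V\setminus\{i,j\}}$, and let $mb^*(j)=\{i\in V : (i,j)\in E^*\}$ be the Markov blanket of $j$ in $G^*$. For every $n$ let $X$ be the $n\times p$ data matrix whose rows are an i.i.d. sample of size $n$ from $N_p(0,(\Omega^*)^{-1})$, and let $S=X^TX$. For $j\in V$ and $mb\subseteq V\setminus\{j\}$ define the local fractional marginal pseudo-likelihood $$p(X_j\mid X_{mb})=\pi^{-\frac{n-1}{2}}\,\frac{\Gamma\left(\frac{n+|mb|}{2}\right)}{\Gamma\left(\frac{|mb|+1}{2}\right)}\,n^{-\frac{2|mb|+1}{2}}\left(\frac{|S_{mb\cup\{j\}}|}{|S_{mb}|}\right)^{-\frac{n-1}{2}},$$ where $|S_A|$ is the determinant of the submatrix of $S$ with rows and columns in $A$, and $|S_\emptyset|=1$. (For $n\ge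 p$ this is well defined with probability $1$.) Then for every $j\in V$ the estimator $$\widehat{mb}(j)=\operatorname*{arg\,max}_{mb\subseteq V\setminus\{j\}}p(X_j\mid X_{mb})$$ is consistent: the probability that $mb^*(j)$ is the unique maximizer, i.e. that $\widehat{mb}(j)=mb^*(j)$, tends to $1$ as $n\to\infty$. -/

import Mathlib

open MeasureTheory ProbabilityTheory Filter Topology

/-- The random vector `x_C = (x_k)_{k ∈ C}` of a vector `x ∈ ℝ^p`. -/
def restrictCoords {p : ℕ} (C : Finset (Fin p)) (x : EuclideanSpace ℝ (Fin p)) : C → ℝ :=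
  fun k => x k

theorem measurable_restrictCoords {p : ℕ} (C : Finset (Fin p)) :
    Measurable (restrictCoords C) := by
  unfold restrictCoords
  fun_prop

/-- For `x` with law `μ`: the components `x_i` and `x_j` are conditionally independent given the
remaining components `x_{V \ {i, j}}`. -/
def CondIndepGivenRest {p : ℕ} (μ : Measure (EuclideanSpace ℝ (Fin p))) [IsFiniteMeasure μ]
    (i j : Fin p) : Prop :=
  CondIndepFun (MeasurableSpace.comap (restrictCoords ({i, j}ᶜ : Finset (Fin p))) inferInstance)
    (measurable_restrictCoords ({i, j}ᶜ : Finset (Fin p))).comap_le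
    (fun x : EuclideanSpace ℝ (Fin p) => x i) (fun x : EuclideanSpace ℝ (Fin p) => x j) μ

theorem CondIndepGivenRest.symm {p : ℕ} {μ : Measure (EuclideanSpace ℝ (Fin p))}
    [IsFiniteMeasure μ] {i j : Fin p} (h : CondIndepGivenRest μ i j) :
    CondIndepGivenRest μ j i := by
  have key : ∀ (C D : Finset (Fin p)) (_ : C = D) (f g : EuclideanSpace ℝ (Fin p) → ℝ),
      CondIndepFun (MeasurableSpace.comap (restrictCoords C) inferInstance)
        (measurable_restrictCoords C).comap_le f g μ →
      CondIndepFun (MeasurableSpace.comap (restrictCoords D) inferInstance)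
        (measurable_restrictCoords D).comap_le g f μ := by
    rintro C _ rfl f g h'
    exact CondIndepFun.symm h'
  exact key _ _ (by rw [Finset.pair_comm]) _ _ h

/-- The undirected conditional independence graph of the law `μ` on `ℝ^p`: distinct nodes `i`, `j`
are not joined by an edge if and only if `x_i` and `x_j` are conditionally independent given all
the remaining components. -/
def condIndepGraph {p : ℕ} (μ : Measure (EuclideanSpace ℝ (Fin p))) [IsFiniteMeasure μ] :
    SimpleGraph (Fin p) where
  Adj i j := i ≠ j ∧ ¬ CondIndepGivenRest μ i j
  symm := ⟨fun _ _ h => ⟨h.1.symm, fun h' => h.2 h'.symm⟩⟩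
  loopless := ⟨fun _ h => h.1 rfl⟩

open Classical in
/-- The Markov blanket of `j` in the graph `G`: the set of neighbours of `j`. -/
noncomputable def markovBlanket {p : ℕ} (G : SimpleGraph (Fin p)) (j : Fin p) :
    Finset (Fin p) :=
  {i | G.Adj j i}

/-- The unscaled sample covariance matrix `S = Xᵀ X` of an `n × p` data matrix. -/
def scatterMatrix {n p : ℕ} (X : Matrix (Fin n) (Fin p) ℝ) : Matrix (Fin p) (Fin p) ℝ :=
  X.transpose * X

/-- `|S_A|`: the determinant of the submatrix with rows and columns in `A` (`1` if `A = ∅`). -/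
def principalMinor {p : ℕ} (S : Matrix (Fin p) (Fin p) ℝ) (A : Finset (Fin p)) : ℝ :=
  (S.submatrix (fun a : A => (a : Fin p)) (fun a : A => (a : Fin p))).det

/-- The local fractional marginal pseudo-likelihood `p(X_j | X_mb)` of the data matrix `X`. -/
noncomputable def localFMPL {n p : ℕ} (X : Matrix (Fin n) (Fin p) ℝ) (j : Fin p)
    (mb : Finset (Fin p)) : ℝ :=
  Real.pi ^ (-(((n : ℝ) - 1) / 2))
    * (Real.Gamma (((n : ℝ) + (mb.card : ℝ)) / 2) / Real.Gamma (((mb.card : ℝ) + 1) / 2))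
    * (n : ℝ) ^ (-((2 * (mb.card : ℝ) + 1) / 2))
    * (principalMinor (scatterMatrix X) (insert j mb) / principalMinor (scatterMatrix X) mb)
        ^ (-(((n : ℝ) - 1) / 2))

/-- The set of all maximizers of `mb ↦ p(X_j | X_mb)` over the subsets `mb` of `V \ {j}`. -/
def argmaxLocalFMPL {n p : ℕ} (X : Matrix (Fin n) (Fin p) ℝ) (j : Fin p) :
    Set (Finset (Fin p)) :=
  {mb | j ∉ mb ∧ ∀ mb' : Finset (Fin p), j ∉ mb' → localFMPL X j mb' ≤ localFMPL X j mb}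

/-! Write `N` for the set of `i ≠ j` with `Ω i j ≠ 0`. Regressing a Gaussian pair on the remaining
coordinates leaves residuals whose covariance is a nonzero multiple of `-Ω i j`, so `N` is the
Markov blanket (`condIndepGivenRest_multivariateGaussian_iff`).

With `T = S / n`, the log score of `A` is a term free of `A`, minus `(n - 1) / 2` times the log of
the residual variance of `j` on `A` under `T`, minus a penalty of order `(|A| / 2) log n`: the power
of `n` costs `|A| log n` and the Gamma factor returns half. If `A` misses a neighbour, its
population residual variance is strictly larger (`residualVar_inv_lt`), and the loss is linear in
`n`. If `A` strictly contains `N`, the penalty is at least `(1 / 2) log n`, while the gain in fit is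
only quadratic in the entrywise error `δ` of `T` (`exists_residualVar_sub_le`), because the residual
variance is a minimum of a quadratic form.

The choice `δ ^ 2 = √(log n) / n` balances both demands: the gain `n δ ^ 2` is `o(log n)`, while
Chebyshev bounds the failure probability of each entry by a constant over `n δ ^ 2 = √(log n)`,
which tends to `0`. Second moments therefore suffice, and everything apart from this event is
deterministic (`eventually_argmaxLocalFMPL_eq`). -/

namespace ProbabilityTheory

/-! ### Conditional independence given a random variable -/

theorem isPiSystem_preimage_inter {Ω β γ : Type*} [MeasurableSpace β] [MeasurableSpace γ]
    (f : Ω → β) (k : Ω → γ) :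
    IsPiSystem {t : Set Ω | ∃ s u, MeasurableSet s ∧ MeasurableSet u ∧
      t = f ⁻¹' s ∩ k ⁻¹' u} := by
  rintro _ ⟨s, u, hs, hu, rfl⟩ _ ⟨s', u', hs', hu', rfl⟩ -
  exact ⟨s ∩ s', u ∩ u', hs.inter hs', hu.inter hu', by ext; simp; tauto⟩

theorem comap_prodMk_eq_generateFrom {Ω β γ : Type*} [MeasurableSpace β] [MeasurableSpace γ]
    (f : Ω → β) (k : Ω → γ) :
    MeasurableSpace.comap (fun ω => (f ω, k ω)) inferInstance =
      MeasurableSpace.generateFrom {t : Set Ω | ∃ s u, MeasurableSet s ∧ MeasurableSet u ∧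
        t = f ⁻¹' s ∩ k ⁻¹' u} := by
  rw [← generateFrom_prod, MeasurableSpace.comap_generateFrom]
  congr 1
  ext t
  constructor
  · rintro ⟨_, ⟨s, hs, u, hu, rfl⟩, rfl⟩
    exact ⟨s, u, hs, hu, rfl⟩
  · rintro ⟨s, u, hs, hu, rfl⟩
    exact ⟨_, ⟨s, hs, u, hu, rfl⟩, rfl⟩

/-- Conditioning variables may be adjoined to both sides of a conditional independence. -/
theorem CondIndepFun.prodMk_cond {Ω β β' γ : Type*} {mΩ : MeasurableSpace Ω}
    [StandardBorelSpace Ω] {mβ : MeasurableSpace β} {mβ' : MeasurableSpace β'}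
    {mγ : MeasurableSpace γ} {μ : Measure Ω} [IsFiniteMeasure μ] {f : Ω → β} {g : Ω → β'}
    {k : Ω → γ} (hf : Measurable f) (hg : Measurable g) (hk : Measurable k)
    (h : CondIndepFun (mγ.comap k) hk.comap_le f g μ) :
    CondIndepFun (mγ.comap k) hk.comap_le (fun ω => (f ω, k ω)) (fun ω => (g ω, k ω)) μ := by
  rw [condIndepFun_iff_condExp_inter_preimage_eq_mul hf hg] at h
  rw [condIndepFun_iff_condIndep]
  refine CondIndepSets.condIndep (hf.prodMk hk).comap_le (hg.prodMk hk).comap_le (isPiSystem_preimage_inter _ _)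
    (isPiSystem_preimage_inter _ _) (comap_prodMk_eq_generateFrom _ _)
    (comap_prodMk_eq_generateFrom _ _) ?_
  rw [condIndepSets_iff]
  rotate_left
  · rintro _ ⟨s, u, hs, hu, rfl⟩
    exact (hf hs).inter (hk hu)
  · rintro _ ⟨s, u, hs, hu, rfl⟩
    exact (hg hs).inter (hk hu)
  -- Indicators of `k`-measurable events pull out of the conditional expectation, so the product
  -- rule extends from `f`, `g` to rectangles.
  have hind : ∀ {A : Set Ω} {u : Set γ}, MeasurableSet A → MeasurableSet u →
      μ⟦A ∩ k ⁻¹' u | mγ.comap k⟧ =ᵐ[μ] (k ⁻¹' u).indicator (μ⟦A | mγ.comap k⟧) := by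
    intro A u hA hu
    rw [Set.inter_comm, ← Set.indicator_indicator]
    exact condExp_indicator ((integrable_const (1 : ℝ)).indicator hA) ⟨u, hu, rfl⟩
  rintro _ _ ⟨s, u, hs, hu, rfl⟩ ⟨s', u', hs', hu', rfl⟩
  have e : (f ⁻¹' s ∩ k ⁻¹' u) ∩ (g ⁻¹' s' ∩ k ⁻¹' u')
      = (f ⁻¹' s ∩ g ⁻¹' s') ∩ k ⁻¹' (u ∩ u') := by ext; simp; tauto
  rw [e]
  filter_upwards [hind ((hf hs).inter (hg hs')) (hu.inter hu'), hind (hf hs) hu,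
    hind (hg hs') hu', h s s' hs hs'] with ω h1 h2 h3 h4
  rw [Pi.mul_apply, h1, h2, h3]
  by_cases hu1 : k ω ∈ u <;> by_cases hu2 : k ω ∈ u' <;> simp [Set.indicator, hu1, hu2, h4]

/-- If `(f, g)` is independent of `k`, then conditional independence of `f` and `g` given `k`
is the same as independence. -/
theorem condIndepFun_iff_indepFun_of_indepFun {Ω β β' γ : Type*} {mΩ : MeasurableSpace Ω}
    [StandardBorelSpace Ω] {mβ : MeasurableSpace β} {mβ' : MeasurableSpace β'}
    {mγ : MeasurableSpace γ} {μ : Measure Ω} [IsProbabilityMeasure μ] {f : Ω → β} {g : Ω → β'}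
    {k : Ω → γ} (hf : Measurable f) (hg : Measurable g) (hk : Measurable k)
    (h : IndepFun (fun ω => (f ω, g ω)) k μ) :
    CondIndepFun (mγ.comap k) hk.comap_le f g μ ↔ IndepFun f g μ := by
  -- Events determined by `(f, g)` have constant conditional probability given `k`.
  have hc : ∀ {A : Set Ω}, MeasurableSet[(mβ.prod mβ').comap (fun ω => (f ω, g ω))] A →
      μ⟦A | mγ.comap k⟧ =ᵐ[μ] fun _ => μ.real A := by
    intro A hA
    have := condExp_indep_eq (μ := μ) (hf.prodMk hg).comap_le hk.comap_le
      (f := A.indicator (fun _ => (1 : ℝ))) (stronglyMeasurable_const.indicator hA) h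
    rwa [integral_indicator_const _ ((hf.prodMk hg).comap_le _ hA), smul_eq_mul, mul_one] at this
  rw [condIndepFun_iff_condExp_inter_preimage_eq_mul hf hg, indepFun_iff_measure_inter_preimage_eq_mul]
  refine forall₂_congr fun s t => forall₂_congr fun hs ht => ?_
  have h1 := hc (A := f ⁻¹' s ∩ g ⁻¹' t) ⟨s ×ˢ t, hs.prod ht, rfl⟩
  have h2 := hc (A := f ⁻¹' s) ⟨Prod.fst ⁻¹' s, measurable_fst hs, rfl⟩
  have h3 := hc (A := g ⁻¹' t) ⟨Prod.snd ⁻¹' t, measurable_snd ht, rfl⟩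
  have key : (μ (f ⁻¹' s ∩ g ⁻¹' t) = μ (f ⁻¹' s) * μ (g ⁻¹' t)) ↔
      μ.real (f ⁻¹' s ∩ g ⁻¹' t) = μ.real (f ⁻¹' s) * μ.real (g ⁻¹' t) := by
    rw [Measure.real, Measure.real, Measure.real, ← ENNReal.toReal_mul, ENNReal.toReal_eq_toReal_iff']
    · exact measure_ne_top _ _
    · exact ENNReal.mul_ne_top (measure_ne_top _ _) (measure_ne_top _ _)
  rw [key]
  constructor
  · intro h
    obtain ⟨ω, h1, h2, h3, h4⟩ := (h1.and (h2.and (h3.and h))).exists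
    simp only at h1 h2 h3 h4
    rw [← h1, h4, h2, h3]
  · intro h
    filter_upwards [h1, h2, h3] with ω h1 h2 h3
    rw [h1, h2, h3, h]

/-- Conditional independence of `f` and `g` given `k` is not affected by adding to (nonzero
multiples of) `f` and `g` functions of `k`. -/
theorem condIndepFun_const_mul_add_iff {Ω γ : Type*} {mΩ : MeasurableSpace Ω}
    [StandardBorelSpace Ω] {mγ : MeasurableSpace γ} {μ : Measure Ω} [IsFiniteMeasure μ]
    {f g : Ω → ℝ} {k : Ω → γ} (hf : Measurable f) (hg : Measurable g) (hk : Measurable k)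
    {c d : ℝ} (hc : c ≠ 0) (hd : d ≠ 0) {φ ψ : γ → ℝ} (hφ : Measurable φ) (hψ : Measurable ψ) :
    CondIndepFun (mγ.comap k) hk.comap_le (fun ω => c * f ω + φ (k ω))
      (fun ω => d * g ω + ψ (k ω)) μ ↔ CondIndepFun (mγ.comap k) hk.comap_le f g μ := by
  constructor
  · intro h
    have h' := (h.prodMk_cond (by fun_prop) (by fun_prop) hk).comp
      (φ := fun q : ℝ × γ => (q.1 - φ q.2) / c) (ψ := fun q : ℝ × γ => (q.1 - ψ q.2) / d)
      (by fun_prop) (by fun_prop)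
    convert h' using 1
    · ext ω; simp [hc]
    · ext ω; simp [hd]
  · intro h
    exact (h.prodMk_cond hf hg hk).comp
      (φ := fun q : ℝ × γ => c * q.1 + φ q.2) (ψ := fun q : ℝ × γ => d * q.1 + ψ q.2)
      (by fun_prop) (by fun_prop)

/-! ### The Gaussian conditional independence graph -/

section Gaussian

variable {p : ℕ} {Ω : Matrix (Fin p) (Fin p) ℝ}

theorem covariance_dotProduct_multivariateGaussian {S : Matrix (Fin p) (Fin p) ℝ}
    (hS : S.PosSemidef) (a b : Fin p → ℝ) :
    cov[fun x => a ⬝ᵥ x.ofLp, fun x => b ⬝ᵥ x.ofLp; multivariateGaussian 0 S]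
      = a ⬝ᵥ S.mulVec b := by
  have h := covarianceBilin_multivariateGaussian (μ := 0) hS (WithLp.toLp 2 a) (WithLp.toLp 2 b)
  rw [covarianceBilin_apply_eq_cov IsGaussian.memLp_two_id] at h
  rw [← h]
  congr 1 <;> ext x <;> simp [PiLp.inner_apply, dotProduct, mul_comm]

/-- In a centred Gaussian vector with precision matrix `Ω`, two components are conditionally
independent given the others iff the corresponding entry of `Ω` vanishes. -/
theorem condIndepGivenRest_multivariateGaussian_iff (hΩ : Ω.PosDef) {i j : Fin p} (hij : i ≠ j) :
    CondIndepGivenRest (multivariateGaussian 0 Ω⁻¹) i j ↔ Ω i j = 0 := by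
  set μ := multivariateGaussian 0 Ω⁻¹ with hμ
  have hsymm : Ω j i = Ω i j := by simpa using hΩ.isHermitian.apply i j
  have hdet : IsUnit Ω.det := hΩ.det_pos.ne'.isUnit
  have hD : 0 < Ω i i * Ω j j - Ω i j * Ω i j := by
    have h := (hΩ.submatrix (e := ![i, j]) (by
      intro a b; fin_cases a <;> fin_cases b <;> simp [hij, hij.symm])).det_pos
    rw [Matrix.det_fin_two] at h
    simpa [hsymm] using h
  set D := Ω i i * Ω j j - Ω i j * Ω i j
  -- `α` and `β` come from the adjugate of the `{i, j}` block of `Ω`. On that block `Ω α` and `Ω β`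
  -- are `D e_i` and `D e_j`, so `u` and `v` are `D x_i` and `D x_j` plus functions of the rest.
  -- Since `Ω⁻¹ a = α` and `Ω⁻¹ b = β` live on `{i, j}`, `u` and `v` are uncorrelated with the rest.
  set α : Fin p → ℝ := Ω j j • Pi.single i 1 - Ω i j • Pi.single j 1 with hα
  set β : Fin p → ℝ := Ω i i • Pi.single j 1 - Ω i j • Pi.single i 1 with hβ
  set a := Ω.mulVec α with ha
  set b := Ω.mulVec β with hb
  have ha' : ∀ k, a k = Ω j j * Ω k i - Ω i j * Ω k j := by
    intro k; simp [ha, hα, Matrix.mulVec_sub, Matrix.mulVec_smul]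
  have hb' : ∀ k, b k = Ω i i * Ω k j - Ω i j * Ω k i := by
    intro k; simp [hb, hβ, Matrix.mulVec_sub, Matrix.mulVec_smul]
  have hinv : ∀ c : Fin p → ℝ, Ω⁻¹.mulVec (Ω.mulVec c) = c := by
    intro c; rw [Matrix.mulVec_mulVec, Matrix.nonsing_inv_mul _ hdet, Matrix.one_mulVec]
  have hS : Ω⁻¹.PosSemidef := hΩ.inv.posSemidef
  set u : EuclideanSpace ℝ (Fin p) → ℝ := fun x => a ⬝ᵥ x.ofLp with hu
  set v : EuclideanSpace ℝ (Fin p) → ℝ := fun x => b ⬝ᵥ x.ofLp with hv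
  have hum : Measurable u := by simp only [hu, dotProduct]; fun_prop
  have hvm : Measurable v := by simp only [hv, dotProduct]; fun_prop
  set C : Finset (Fin p) := {i, j}ᶜ with hC
  have hcov : cov[u, v; μ] = -(Ω i j * D) := by
    rw [covariance_dotProduct_multivariateGaussian hS, hinv, hβ]
    simp [dotProduct_sub, ha', D, hsymm]
    ring
  have hcoord : ∀ k ∈ C, ∀ c : Fin p → ℝ, c k = 0 →
      cov[fun x => (Ω.mulVec c) ⬝ᵥ x.ofLp, fun x => x k; μ] = 0 := by
    intro k hk c hc
    have h := covariance_dotProduct_multivariateGaussian hS (Pi.single k 1) (Ω.mulVec c)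
    rw [hinv, covariance_comm] at h
    simpa [hc] using h
  have hind : IndepFun (fun x => (u x, v x)) (restrictCoords C) μ := by
    have hG : HasGaussianLaw (fun x : EuclideanSpace ℝ (Fin p) =>
        ((fun s => ![u, v] s x), (fun k : C => x k))) μ := by
      let L : EuclideanSpace ℝ (Fin p) →ₗ[ℝ] (Fin 2 → ℝ) × (C → ℝ) :=
        { toFun := fun x => ((fun s => ![u, v] s x), (fun k : C => x k))
          map_add' := by
            intro x y
            ext s
            · fin_cases s <;> simp [u, v, dotProduct_add]
            · simp
          map_smul' := by
            intro c x
            ext s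
            · fin_cases s <;> simp [u, v, dotProduct_smul]
            · simp }
      exact (IsGaussian.hasGaussianLaw_id (μ := μ)).map (LinearMap.toContinuousLinearMap L)
    have h := hG.indepFun_of_covariance_eval (fun s k => by
      have hk : (k : Fin p) ≠ i ∧ (k : Fin p) ≠ j := by simpa [hC] using k.2
      fin_cases s
      · exact hcoord k k.2 α (by simp [hα, hk.1, hk.2])
      · exact hcoord k k.2 β (by simp [hβ, hk.1, hk.2]))
    exact h.comp (φ := fun q : Fin 2 → ℝ => (q 0, q 1)) (ψ := id) (by fun_prop) measurable_id
  have hsum : ∀ (c : Fin p → ℝ) (x : EuclideanSpace ℝ (Fin p)),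
      c ⬝ᵥ x.ofLp = c i * x i + c j * x j + ∑ k : C, c k * restrictCoords C x k := by
    intro c x
    have h1 : ∑ k : C, c k * restrictCoords C x k = ∑ k ∈ C, c k * x k :=
      Finset.sum_coe_sort C (fun k => c k * x k)
    rw [h1, dotProduct, ← Finset.sum_add_sum_compl {i, j}, Finset.sum_pair hij]
  have e1 := condIndepFun_const_mul_add_iff (μ := μ) (f := fun x => x i) (g := fun x => x j)
    (by fun_prop) (by fun_prop) (measurable_restrictCoords C) hD.ne' hD.ne'
    (φ := fun z => ∑ k : C, a k * z k) (ψ := fun z => ∑ k : C, b k * z k)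
    (by fun_prop) (by fun_prop)
  have e2 : (fun x : EuclideanSpace ℝ (Fin p) =>
      D * x i + ∑ k : C, a k * restrictCoords C x k) = u := by
    ext x
    simp only [hu, hsum, ha', hsymm, D]
    ring
  have e3 : (fun x : EuclideanSpace ℝ (Fin p) =>
      D * x j + ∑ k : C, b k * restrictCoords C x k) = v := by
    ext x
    simp only [hv, hsum, hb', hsymm, D]
    ring
  rw [e2, e3, condIndepFun_iff_indepFun_of_indepFun hum hvm (measurable_restrictCoords C) hind]
    at e1
  rw [CondIndepGivenRest, ← e1]
  have hG2 : HasGaussianLaw (fun x => (u x, v x)) μ := by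
    let L : EuclideanSpace ℝ (Fin p) →ₗ[ℝ] ℝ × ℝ :=
      { toFun := fun x => (u x, v x)
        map_add' := by intro x y; simp [u, v, dotProduct_add]
        map_smul' := by intro c x; simp [u, v, dotProduct_smul] }
    exact (IsGaussian.hasGaussianLaw_id (μ := μ)).map (LinearMap.toContinuousLinearMap L)
  constructor
  · intro h
    have h0 := h.covariance_eq_zero hG2.fst.memLp_two hG2.snd.memLp_two
    rw [hcov] at h0
    simpa [hD.ne'] using h0
  · intro h
    exact hG2.indepFun_of_covariance_eq_zero (by rw [hcov, h]; ring)

theorem markovBlanket_condIndepGraph_multivariateGaussian (hΩ : Ω.PosDef) (j : Fin p) :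
    markovBlanket (condIndepGraph (multivariateGaussian 0 Ω⁻¹)) j
      = ({i | i ≠ j ∧ Ω i j ≠ 0} : Finset (Fin p)) := by
  ext i
  have hsymm : Ω j i = Ω i j := by simpa using hΩ.isHermitian.apply i j
  simp only [markovBlanket, Finset.mem_filter, Finset.mem_univ, true_and]
  constructor
  · rintro ⟨h1, h2⟩
    exact ⟨h1.symm, by rwa [condIndepGivenRest_multivariateGaussian_iff hΩ h1, hsymm] at h2⟩
  · rintro ⟨h1, h2⟩
    exact ⟨h1.symm, by rwa [condIndepGivenRest_multivariateGaussian_iff hΩ h1.symm, hsymm]⟩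

end Gaussian

end ProbabilityTheory

/-! ### Residual variances as minima of quadratic forms -/

section PrincipalMinor

open Matrix

variable {p : ℕ}

theorem principalMinor_pos {T : Matrix (Fin p) (Fin p) ℝ} (hT : T.PosDef) (A : Finset (Fin p)) :
    0 < principalMinor T A :=
  (hT.submatrix Subtype.val_injective).det_pos

theorem principalMinor_smul (c : ℝ) (T : Matrix (Fin p) (Fin p) ℝ) (A : Finset (Fin p)) :
    principalMinor (c • T) A = c ^ A.card * principalMinor T A := by
  have h : (c • T).submatrix (fun a : A => (a : Fin p)) (fun a : A => (a : Fin p))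
      = c • T.submatrix (fun a : A => (a : Fin p)) (fun a : A => (a : Fin p)) := rfl
  rw [principalMinor, principalMinor, h, det_smul]
  simp

theorem continuous_principalMinor (A : Finset (Fin p)) :
    Continuous fun T : Matrix (Fin p) (Fin p) ℝ => principalMinor T A := by
  unfold principalMinor
  fun_prop

/-- The inclusion of `A` and an additional index `j` into the index set. -/
def insertIncl (A : Finset (Fin p)) (j : Fin p) : A ⊕ Unit → Fin p :=
  Sum.elim (fun a => (a : Fin p)) (fun _ => j)

theorem insertIncl_injective {A : Finset (Fin p)} {j : Fin p} (hj : j ∉ A) :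
    Function.Injective (insertIncl A j) := by
  rintro (a | a) (b | b) h
  · exact congrArg _ (Subtype.ext h)
  · exact absurd (show (a : Fin p) = j from h) (fun e => hj (e ▸ a.2))
  · exact absurd (show j = (b : Fin p) from h) (fun e => hj (e ▸ b.2))
  · rfl

/-- The residual variance of the regression of the component `j` on the components in `A`. -/
noncomputable def residualVar (T : Matrix (Fin p) (Fin p) ℝ) (j : Fin p) (A : Finset (Fin p)) : ℝ :=
  principalMinor T (insert j A) / principalMinor T A

theorem residualVar_pos {T : Matrix (Fin p) (Fin p) ℝ} (hT : T.PosDef) (j : Fin p)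
    (A : Finset (Fin p)) : 0 < residualVar T j A :=
  div_pos (principalMinor_pos hT _) (principalMinor_pos hT _)

theorem residualVar_smul {c : ℝ} (hc : c ≠ 0) (T : Matrix (Fin p) (Fin p) ℝ) {j : Fin p}
    {A : Finset (Fin p)} (hj : j ∉ A) : residualVar (c • T) j A = c * residualVar T j A := by
  rw [residualVar, residualVar, principalMinor_smul, principalMinor_smul,
    Finset.card_insert_of_notMem hj, pow_succ, mul_assoc, mul_div_mul_left _ _ (pow_ne_zero _ hc),
    mul_div_assoc]

theorem tendsto_residualVar {S : Matrix (Fin p) (Fin p) ℝ} (hS : S.PosDef) (j : Fin p)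
    (A : Finset (Fin p)) :
    Tendsto (fun T => residualVar T j A) (𝓝 S) (𝓝 (residualVar S j A)) :=
  ((continuous_principalMinor _).tendsto _).div ((continuous_principalMinor _).tendsto _)
    (principalMinor_pos hS A).ne'

/-- Completing the square: the ratio of determinants is the Schur complement of the `A` block, and
`w` is `TA⁻¹ B`. -/
theorem exists_quadForm_eq_add_residualVar {T : Matrix (Fin p) (Fin p) ℝ} (hT : T.PosDef)
    {j : Fin p} {A : Finset (Fin p)} (hj : j ∉ A) :
    ∃ w : A → ℝ, ∀ x : A → ℝ,
      (Sum.elim x 1) ⬝ᵥ (T.submatrix (insertIncl A j) (insertIncl A j)) *ᵥ (Sum.elim x 1) =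
        (x + w) ⬝ᵥ (T.submatrix (fun a : A => (a : Fin p)) (fun a : A => (a : Fin p))) *ᵥ (x + w)
          + residualVar T j A := by
  set M := T.submatrix (insertIncl A j) (insertIncl A j) with hM
  set TA := T.submatrix (fun a : A => (a : Fin p)) (fun a : A => (a : Fin p)) with hTA
  have hTApd : TA.PosDef := hT.submatrix Subtype.val_injective
  set B : Matrix A Unit ℝ := Matrix.of fun a _ => T a j with hB
  set D : Matrix Unit Unit ℝ := Matrix.of fun _ _ => T j j with hD
  have hMb : M = fromBlocks TA B Bᴴ D := by
    ext a b
    rcases a with a | a <;> rcases b with b | b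
    · rfl
    · rfl
    · simpa [hM, insertIncl, hB] using (hT.isHermitian.apply j b).symm
    · rfl
  have : Invertible TA := TA.invertibleOfIsUnitDet hTApd.det_pos.ne'.isUnit
  have hdetM : M.det = principalMinor T (insert j A) := by
    let e : A ⊕ Unit ≃ (insert j A : Finset (Fin p)) := Equiv.ofBijective
      (fun s => ⟨insertIncl A j s, by rcases s with a | a <;> simp [insertIncl]⟩) (by
        constructor
        · intro s t h
          exact insertIncl_injective hj (congrArg Subtype.val h)
        · rintro ⟨k, hk⟩
          rcases Finset.mem_insert.1 hk with rfl | hk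
          · exact ⟨Sum.inr (), rfl⟩
          · exact ⟨Sum.inl ⟨k, hk⟩, rfl⟩)
    rw [principalMinor, ← det_submatrix_equiv_self e]
    rfl
  have hres : residualVar T j A = (D - Bᴴ * TA⁻¹ * B) () () := by
    rw [residualVar, ← hdetM, hMb, det_fromBlocks₁₁, invOf_eq_nonsing_inv]
    rw [show principalMinor T A = TA.det from rfl, mul_div_cancel_left₀ _ hTApd.det_pos.ne',
      det_unique]
  refine ⟨(TA⁻¹ * B) *ᵥ 1, fun x => ?_⟩
  have h := schur_complement_eq₁₁ B D x 1 hTApd.isHermitian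
  rw [← hMb] at h
  simp only [star_trivial, ← dotProduct_mulVec] at h
  rw [h, hres]
  congr 1
  simp [dotProduct, mulVec]

theorem quadForm_eq_submatrix_insertIncl (T : Matrix (Fin p) (Fin p) ℝ) {j : Fin p}
    {A : Finset (Fin p)} (hj : j ∉ A) {c : Fin p → ℝ} (hc : ∀ k ∉ insert j A, c k = 0) :
    c ⬝ᵥ T *ᵥ c = (c ∘ insertIncl A j) ⬝ᵥ
      (T.submatrix (insertIncl A j) (insertIncl A j)) *ᵥ (c ∘ insertIncl A j) := by
  have hsum : ∀ d : Fin p → ℝ, ∑ k, c k * d k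
      = ∑ s, c (insertIncl A j s) * d (insertIncl A j s) := by
    intro d
    rw [← Finset.sum_subset (Finset.subset_univ (insert j A))
      (fun k _ hk => by rw [hc k hk, zero_mul]), Finset.sum_insert hj, Fintype.sum_sum_type,
      add_comm, ← Finset.sum_coe_sort A]
    simp [insertIncl]
  simp only [dotProduct, mulVec, Function.comp_apply, submatrix_apply]
  rw [hsum]
  refine Finset.sum_congr rfl fun s _ => ?_
  congr 1
  simpa [mul_comm] using hsum (fun k => T (insertIncl A j s) k)

/-- The remaining square is nonnegative; with `exists_quadForm_eq_residualVar` this characterises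
the residual variance as a minimum. -/
theorem residualVar_le_quadForm {T : Matrix (Fin p) (Fin p) ℝ} (hT : T.PosDef)
    {j : Fin p} {A : Finset (Fin p)} (hj : j ∉ A) {c : Fin p → ℝ} (hcj : c j = 1)
    (hc : ∀ k ∉ insert j A, c k = 0) : residualVar T j A ≤ c ⬝ᵥ T *ᵥ c := by
  obtain ⟨w, hw⟩ := exists_quadForm_eq_add_residualVar hT hj
  have e : c ∘ insertIncl A j = Sum.elim (fun a : A => c a) 1 := by
    ext s; rcases s with a | a <;> simp [insertIncl, hcj]
  rw [quadForm_eq_submatrix_insertIncl T hj hc, e, hw]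
  have h := (hT.submatrix (e := fun a : A => (a : Fin p))
    Subtype.val_injective).posSemidef.dotProduct_mulVec_nonneg ((fun a : A => c a) + w)
  simp only [star_trivial] at h
  linarith

theorem exists_quadForm_eq_residualVar {T : Matrix (Fin p) (Fin p) ℝ} (hT : T.PosDef)
    {j : Fin p} {A : Finset (Fin p)} (hj : j ∉ A) :
    ∃ c : Fin p → ℝ, c j = 1 ∧ (∀ k ∉ insert j A, c k = 0) ∧ c ⬝ᵥ T *ᵥ c = residualVar T j A := by
  obtain ⟨w, hw⟩ := exists_quadForm_eq_add_residualVar hT hj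
  refine ⟨fun k => if h : k ∈ A then -w ⟨k, h⟩ else if k = j then 1 else 0, by simp [hj], ?_, ?_⟩
  · intro k hk
    rw [Finset.mem_insert, not_or] at hk
    simp [hk.1, hk.2]
  · rw [quadForm_eq_submatrix_insertIncl T hj]
    · have := hw (-w)
      simp only [neg_add_cancel, zero_dotProduct, zero_add] at this
      rw [← this]
      have e : (fun k => if h : k ∈ A then -w ⟨k, h⟩ else if k = j then (1 : ℝ) else 0) ∘
          insertIncl A j = Sum.elim (-w) 1 := by
        ext s; rcases s with a | a <;> simp [insertIncl, hj]
      rw [e]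
    · intro k hk
      rw [Finset.mem_insert, not_or] at hk
      simp [hk.1, hk.2]

theorem abs_quadForm_le {E : Matrix (Fin p) (Fin p) ℝ} {δ : ℝ} (hE : ∀ a b, |E a b| ≤ δ)
    (d : Fin p → ℝ) : |d ⬝ᵥ E *ᵥ d| ≤ δ * p * (d ⬝ᵥ d) := by
  have h1 : |d ⬝ᵥ E *ᵥ d| ≤ ∑ a, ∑ b, δ * (|d a| * |d b|) := by
    simp only [dotProduct, mulVec, Finset.mul_sum]
    refine (Finset.abs_sum_le_sum_abs _ _).trans (Finset.sum_le_sum fun a _ => ?_)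
    refine (Finset.abs_sum_le_sum_abs _ _).trans (Finset.sum_le_sum fun b _ => ?_)
    rw [abs_mul, abs_mul]
    nlinarith [hE a b, mul_nonneg (abs_nonneg (d a)) (abs_nonneg (d b))]
  have h2 : ∑ a, ∑ b, δ * (|d a| * |d b|) = δ * (∑ a, |d a|) ^ 2 := by
    rw [sq, Finset.sum_mul_sum, Finset.mul_sum]
    simp_rw [Finset.mul_sum]
  have h3 : (∑ a, |d a|) ^ 2 ≤ p * (d ⬝ᵥ d) := by
    have := sq_sum_le_card_mul_sum_sq (s := Finset.univ) (f := fun a => |d a|)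
    simpa [dotProduct, sq] using this
  rcases isEmpty_or_nonempty (Fin p) with hp | ⟨⟨a⟩⟩
  · simp
  have hδ : 0 ≤ δ := (abs_nonneg _).trans (hE a a)
  calc |d ⬝ᵥ E *ᵥ d| ≤ δ * (∑ a, |d a|) ^ 2 := h1.trans_eq h2
    _ ≤ δ * (p * (d ⬝ᵥ d)) := by gcongr
    _ = _ := by ring

theorem dotProduct_mulVec_comm_of_isHermitian {T : Matrix (Fin p) (Fin p) ℝ}
    (hT : T.IsHermitian) (c d : Fin p → ℝ) : c ⬝ᵥ T *ᵥ d = d ⬝ᵥ T *ᵥ c := by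
  have h : Tᵀ = T := by simpa [IsHermitian] using hT.eq
  rw [dotProduct_mulVec, ← mulVec_transpose, h, dotProduct_comm]

theorem quadForm_sub {T : Matrix (Fin p) (Fin p) ℝ} (hT : T.IsHermitian) (b c : Fin p → ℝ) :
    c ⬝ᵥ T *ᵥ c = b ⬝ᵥ T *ᵥ b + 2 * ((c - b) ⬝ᵥ T *ᵥ b) + (c - b) ⬝ᵥ T *ᵥ (c - b) := by
  rw [mulVec_sub]
  simp only [sub_dotProduct, dotProduct_sub]
  rw [dotProduct_mulVec_comm_of_isHermitian hT b c]
  ring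

/-- A positive definite matrix is bounded below by a positive multiple of the identity. -/
theorem exists_pos_mul_dotProduct_le_quadForm_inv {Ω : Matrix (Fin p) (Fin p) ℝ}
    (hΩ : Ω.PosDef) : ∃ l > 0, ∀ d : Fin p → ℝ, l * (d ⬝ᵥ d) ≤ d ⬝ᵥ Ω⁻¹ *ᵥ d := by
  have hdet : IsUnit Ω.det := hΩ.det_pos.ne'.isUnit
  set M := ∑ a, ∑ b, |Ω a b| with hM
  have hM0 : 0 ≤ M := Finset.sum_nonneg fun a _ => Finset.sum_nonneg fun b _ => abs_nonneg _
  have hle : ∀ a b, |Ω a b| ≤ M := fun a b =>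
    (Finset.single_le_sum (f := fun b => |Ω a b|) (fun _ _ => abs_nonneg _)
      (Finset.mem_univ b)).trans
    (Finset.single_le_sum (f := fun a => ∑ b, |Ω a b|)
      (fun _ _ => Finset.sum_nonneg fun _ _ => abs_nonneg _) (Finset.mem_univ a))
  set K := M * p + 1 with hK
  have hK0 : 0 < K := by positivity
  refine ⟨K⁻¹, inv_pos.2 hK0, fun d => ?_⟩
  have hd0 : 0 ≤ d ⬝ᵥ d := by
    simpa using dotProduct_star_self_nonneg d
  -- Expanding this form and using `d ⬝ᵥ Ω *ᵥ d ≤ K * (d ⬝ᵥ d)` gives the bound without eigenvalues.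
  have h1 := hΩ.inv.posSemidef.dotProduct_mulVec_nonneg (K⁻¹ • Ω *ᵥ d - d)
  rw [star_trivial] at h1
  have h2 := quadForm_sub hΩ.inv.isHermitian d (K⁻¹ • Ω *ᵥ d)
  generalize (K⁻¹ • Ω *ᵥ d - d) ⬝ᵥ Ω⁻¹ *ᵥ (K⁻¹ • Ω *ᵥ d - d) = q at h1 h2
  have hinv : Ω⁻¹ *ᵥ (Ω *ᵥ d) = d := by
    rw [mulVec_mulVec, nonsing_inv_mul _ hdet, one_mulVec]
  have h3 : d ⬝ᵥ Ω⁻¹ *ᵥ (Ω *ᵥ d) = d ⬝ᵥ d := by rw [hinv]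
  have h4 : (Ω *ᵥ d) ⬝ᵥ Ω⁻¹ *ᵥ d = d ⬝ᵥ d := by
    rw [dotProduct_mulVec_comm_of_isHermitian hΩ.inv.isHermitian, h3]
  simp only [mulVec_smul, smul_dotProduct, dotProduct_smul, sub_dotProduct, hinv, h4,
    smul_eq_mul] at h2
  rw [dotProduct_comm (Ω *ᵥ d) d] at h2
  have h5 : d ⬝ᵥ Ω *ᵥ d ≤ K * (d ⬝ᵥ d) := by
    have := (le_abs_self _).trans (abs_quadForm_le hle d)
    nlinarith
  have h6 : K⁻¹ * (K⁻¹ * (d ⬝ᵥ Ω *ᵥ d)) ≤ K⁻¹ * (d ⬝ᵥ d) := by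
    calc K⁻¹ * (K⁻¹ * (d ⬝ᵥ Ω *ᵥ d)) ≤ K⁻¹ * (K⁻¹ * (K * (d ⬝ᵥ d))) := by gcongr
      _ = _ := by field_simp
  nlinarith

/-- The coefficient vector of the regression residual of the component `j` on all others. -/
noncomputable def residualVec (Ω : Matrix (Fin p) (Fin p) ℝ) (j : Fin p) : Fin p → ℝ :=
  fun k => Ω k j / Ω j j

theorem residualVec_self {Ω : Matrix (Fin p) (Fin p) ℝ} (hΩ : Ω.PosDef) (j : Fin p) :
    residualVec Ω j j = 1 :=
  div_self hΩ.diag_pos.ne'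

/-- The normal equations: `Ω⁻¹` sends the residual vector to a multiple of the `j`-th basis vector.
-/
theorem dotProduct_inv_mulVec_residualVec {Ω : Matrix (Fin p) (Fin p) ℝ} (hΩ : Ω.PosDef)
    {j : Fin p} {d : Fin p → ℝ} (hd : d j = 0) : d ⬝ᵥ Ω⁻¹ *ᵥ residualVec Ω j = 0 := by
  have h : residualVec Ω j = (Ω j j)⁻¹ • (Ω *ᵥ Pi.single j 1) := by
    ext k; simp [residualVec, div_eq_inv_mul]
  rw [h, mulVec_smul, mulVec_mulVec, nonsing_inv_mul _ hΩ.det_pos.ne'.isUnit, one_mulVec]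
  simp [hd]

/-- By the normal equations, the form at the minimiser `c` for `A` exceeds its value at `b` by the
form at `c - b`. This is nonzero: at a neighbour outside `A`, `c` vanishes and `b` does not. -/
theorem residualVar_inv_lt {Ω : Matrix (Fin p) (Fin p) ℝ} (hΩ : Ω.PosDef) {j : Fin p}
    {A : Finset (Fin p)} (hj : j ∉ A)
    (hA : ¬ ({i | i ≠ j ∧ Ω i j ≠ 0} : Finset (Fin p)) ⊆ A) :
    residualVar Ω⁻¹ j {i | i ≠ j ∧ Ω i j ≠ 0} < residualVar Ω⁻¹ j A := by
  set b := residualVec Ω j with hb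
  have hbj : b j = 1 := residualVec_self hΩ j
  obtain ⟨c, hcj, hc, hcr⟩ := exists_quadForm_eq_residualVar hΩ.inv hj
  have h1 : residualVar Ω⁻¹ j {i | i ≠ j ∧ Ω i j ≠ 0} ≤ b ⬝ᵥ Ω⁻¹ *ᵥ b := by
    refine residualVar_le_quadForm hΩ.inv (by simp) hbj fun k hk => ?_
    have : Ω k j = 0 := by by_contra h; simp_all
    simp [hb, residualVec, this]
  have h2 := quadForm_sub hΩ.inv.isHermitian b c
  rw [dotProduct_inv_mulVec_residualVec hΩ (d := c - b) (by simp [hbj, hcj])] at h2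
  have h3 : c - b ≠ 0 := by
    intro h
    obtain ⟨i, hi, hiA⟩ := Finset.not_subset.1 hA
    simp only [Finset.mem_filter, Finset.mem_univ, true_and] at hi
    have h0 := congrFun h i
    rw [Pi.sub_apply, hc i (by simp [hi.1, hiA])] at h0
    have : b i ≠ 0 := div_ne_zero hi.2 hΩ.diag_pos.ne'
    simp_all
  have h4 := hΩ.inv.dotProduct_mulVec_pos h3
  rw [star_trivial] at h4
  linarith

/-- `b` competes in the minimum for the blanket under every `T`, so the difference is at most `-2 d
⬝ᵥ T b - d ⬝ᵥ T d` with `d = c - b`. The normal equations replace `T b` by `v = (T - Ω⁻¹) b`, of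
size `O(δ)`; maximising over `d` leaves `O(δ ^ 2)`. -/
theorem exists_residualVar_sub_le {Ω : Matrix (Fin p) (Fin p) ℝ} (hΩ : Ω.PosDef) (j : Fin p) :
    ∃ K, ∃ δ₀ > 0, ∀ δ ≤ δ₀, ∀ T : Matrix (Fin p) (Fin p) ℝ, T.IsHermitian →
      (∀ a b, |T a b - Ω⁻¹ a b| ≤ δ) → T.PosDef ∧ ∀ A : Finset (Fin p), j ∉ A →
        ({i | i ≠ j ∧ Ω i j ≠ 0} : Finset (Fin p)) ⊆ A →
        residualVar T j {i | i ≠ j ∧ Ω i j ≠ 0} - residualVar T j A ≤ K * δ ^ 2 := by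
  obtain ⟨l, hl, hle⟩ := exists_pos_mul_dotProduct_le_quadForm_inv hΩ
  set b := residualVec Ω j with hb
  have hbj : b j = 1 := residualVec_self hΩ j
  have hp : 0 < (p : ℝ) := by exact_mod_cast j.pos
  -- `l / (2 * p)` keeps the form of `T` above half that of `l` times the identity; the first
  -- constant is `2 / l` times the bound on `v ⬝ᵥ v / δ ^ 2`.
  refine ⟨2 / l * (p * (∑ k, |b k|) ^ 2), l / (2 * p), by positivity, fun δ hδ T hT hTδ => ?_⟩
  have hlow : ∀ d : Fin p → ℝ, l / 2 * (d ⬝ᵥ d) ≤ d ⬝ᵥ T *ᵥ d := by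
    intro d
    have h1 := (abs_le.1 (abs_quadForm_le (E := T - Ω⁻¹) hTδ d)).1
    rw [sub_mulVec, dotProduct_sub] at h1
    have hd0 : 0 ≤ d ⬝ᵥ d := by simpa using dotProduct_star_self_nonneg d
    have h2 : δ * p ≤ l / 2 := by
      calc δ * p ≤ l / (2 * p) * p := by gcongr
        _ = l / 2 := by field_simp
    nlinarith [hle d, mul_le_mul_of_nonneg_right h2 hd0]
  have hTpd : T.PosDef := by
    refine PosDef.of_dotProduct_mulVec_pos hT fun d hd => ?_
    have h0 : 0 < d ⬝ᵥ d := by simpa using dotProduct_star_self_pos_iff.2 hd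
    rw [star_trivial]
    exact lt_of_lt_of_le (by positivity) (hlow d)
  refine ⟨hTpd, fun A hj hA => ?_⟩
  obtain ⟨c, hcj, hc, hcr⟩ := exists_quadForm_eq_residualVar hTpd hj
  have h1 : residualVar T j {i | i ≠ j ∧ Ω i j ≠ 0} ≤ b ⬝ᵥ T *ᵥ b := by
    refine residualVar_le_quadForm hTpd (by simp) hbj fun k hk => ?_
    have : Ω k j = 0 := by by_contra h; simp_all
    simp [hb, residualVec, this]
  set d := c - b with hd
  set v := (T - Ω⁻¹) *ᵥ b with hv
  have h2 := quadForm_sub hT b c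
  have h3 : d ⬝ᵥ T *ᵥ b = d ⬝ᵥ v := by
    rw [hv, sub_mulVec, dotProduct_sub,
      dotProduct_inv_mulVec_residualVec hΩ (by simp [hd, hbj, hcj]), sub_zero]
  have h4 : 0 ≤ ((l / 2) • d + v) ⬝ᵥ ((l / 2) • d + v) := by
    simpa using dotProduct_star_self_nonneg ((l / 2) • d + v)
  simp only [add_dotProduct, dotProduct_add, smul_dotProduct, dotProduct_smul, smul_eq_mul,
    dotProduct_comm v d] at h4
  have h5 : v ⬝ᵥ v ≤ p * (∑ k, |b k|) ^ 2 * δ ^ 2 := by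
    have hvk : ∀ k, v k * v k ≤ (δ * ∑ k, |b k|) ^ 2 := by
      intro k
      have : |v k| ≤ δ * ∑ k, |b k| := by
        rw [hv, mulVec, dotProduct, Finset.mul_sum]
        refine (Finset.abs_sum_le_sum_abs _ _).trans (Finset.sum_le_sum fun m _ => ?_)
        rw [abs_mul]
        exact mul_le_mul_of_nonneg_right (hTδ k m) (abs_nonneg _)
      rw [← sq, ← sq_abs]
      gcongr
    calc v ⬝ᵥ v ≤ ∑ _k : Fin p, (δ * ∑ k, |b k|) ^ 2 := Finset.sum_le_sum fun k _ => hvk k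
      _ = _ := by simp; ring
  have h6 : - (2 / l) * (v ⬝ᵥ v) ≤ 2 * (d ⬝ᵥ v) + l / 2 * (d ⬝ᵥ d) := by
    have : 2 * (d ⬝ᵥ v) + l / 2 * (d ⬝ᵥ d) + (2 / l) * (v ⬝ᵥ v)
        = (2 / l) * (l / 2 * (l / 2 * d ⬝ᵥ d) + l / 2 * d ⬝ᵥ v
          + (l / 2 * d ⬝ᵥ v + v ⬝ᵥ v)) := by field_simp; ring
    have h0 : 0 ≤ (2 / l) * (l / 2 * (l / 2 * d ⬝ᵥ d) + l / 2 * d ⬝ᵥ v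
          + (l / 2 * d ⬝ᵥ v + v ⬝ᵥ v)) := mul_nonneg (by positivity) (by linarith)
    linarith
  have h7 := mul_le_mul_of_nonneg_left h5 (show 0 ≤ 2 / l by positivity)
  have h8 := hlow d
  rw [h3] at h2
  linarith

end PrincipalMinor

/-! ### Comparison of scores for a scatter matrix close to its mean -/

section Score

/-- Log-convexity at the midpoint of `x` and `x + 1`, with the functional equation. -/
theorem Real.log_Gamma_add_half_le {x : ℝ} (hx : 0 < x) :
    Real.log (Real.Gamma (x + 1 / 2)) ≤ Real.log (Real.Gamma x) + 1 / 2 * Real.log x := by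
  have hx1 : x + 1 ∈ Set.Ioi (0 : ℝ) := by rw [Set.mem_Ioi]; linarith
  have h := Real.convexOn_log_Gamma.2 (show x ∈ Set.Ioi (0 : ℝ) from hx) hx1
    (show (0 : ℝ) ≤ 1 / 2 by norm_num) (show (0 : ℝ) ≤ 1 / 2 by norm_num) (by norm_num)
  simp only [smul_eq_mul, Function.comp_apply] at h
  rw [show (1 / 2 : ℝ) * x + 1 / 2 * (x + 1) = x + 1 / 2 by ring, Real.Gamma_add_one hx.ne',
    Real.log_mul hx.ne' (Real.Gamma_pos_of_pos hx).ne'] at h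
  linarith

theorem Real.log_Gamma_add_natCast_div_two_le {x : ℝ} (hx : 0 < x) (m : ℕ) {y : ℝ}
    (hy : x + m / 2 ≤ y) :
    Real.log (Real.Gamma (x + m / 2)) ≤ Real.log (Real.Gamma x) + m / 2 * Real.log y := by
  induction m with
  | zero => simp
  | succ m ih =>
    push_cast at hy ⊢
    have hm : (0 : ℝ) ≤ m := m.cast_nonneg
    have h1 := ih (by linarith)
    have h2 := Real.log_Gamma_add_half_le (x := x + m / 2) (by positivity)
    have h3 : Real.log (x + m / 2) ≤ Real.log y :=
      Real.log_le_log (by positivity) (by linarith)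
    rw [show x + ((m : ℝ) + 1) / 2 = x + m / 2 + 1 / 2 by ring]
    linarith

/-- Truncated subtraction covers both orders. For `a ≤ k` monotonicity of Gamma on `[2, ∞)`
suffices, whence `4 ≤ n`; otherwise one takes `a - k` half steps, each costing at most `log n / 2`
because `a ≤ n`. -/
theorem log_Gamma_add_div_two_sub_le {n a k : ℕ} (hn : 4 ≤ n) (ha : a ≤ n) :
    Real.log (Real.Gamma (((n : ℝ) + a) / 2)) - Real.log (Real.Gamma (((n : ℝ) + k) / 2))
      ≤ ((a - k : ℕ) : ℝ) / 2 * Real.log n := by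
  have hn' : (4 : ℝ) ≤ n := by exact_mod_cast hn
  have ha' : (a : ℝ) ≤ n := by exact_mod_cast ha
  have hk0 : (0 : ℝ) ≤ k := k.cast_nonneg
  have ha0 : (0 : ℝ) ≤ a := a.cast_nonneg
  rcases le_total a k with h | h
  · have h' : (a : ℝ) ≤ k := by exact_mod_cast h
    have h1 : Real.Gamma (((n : ℝ) + a) / 2) ≤ Real.Gamma (((n : ℝ) + k) / 2) :=
      Real.Gamma_strictMonoOn_Ici.monotoneOn (by simp; linarith) (by simp; linarith)
        (by linarith)
    have h2 := Real.log_le_log (Real.Gamma_pos_of_pos (by positivity)) h1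
    rw [Nat.sub_eq_zero_of_le h]
    simp only [Nat.cast_zero, zero_div, zero_mul]
    linarith
  · obtain ⟨m, rfl⟩ := Nat.exists_eq_add_of_le h
    push_cast at ha' ⊢
    have h1 := Real.log_Gamma_add_natCast_div_two_le (x := ((n : ℝ) + k) / 2) (by positivity) m
      (y := n) (by linarith)
    rw [show ((n : ℝ) + (k + m)) / 2 = ((n : ℝ) + k) / 2 + m / 2 by ring,
      Nat.add_sub_cancel_left]
    linarith

variable {p : ℕ}

/-- The logarithm of the local score, as a function of the normalised scatter matrix, up to a
term which does not depend on `A`. -/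
noncomputable def logScore (n : ℕ) (T : Matrix (Fin p) (Fin p) ℝ) (j : Fin p)
    (A : Finset (Fin p)) : ℝ :=
  Real.log (Real.Gamma (((n : ℝ) + A.card) / 2)) - Real.log (Real.Gamma (((A.card : ℝ) + 1) / 2))
    - A.card * Real.log n - ((n : ℝ) - 1) / 2 * Real.log (residualVar T j A)

theorem localFMPL_pos {n : ℕ} (hn : 0 < n) (X : Matrix (Fin n) (Fin p) ℝ)
    {T : Matrix (Fin p) (Fin p) ℝ} (hT : T.PosDef) (hX : scatterMatrix X = (n : ℝ) • T)
    {j : Fin p} {A : Finset (Fin p)} (hj : j ∉ A) :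
    0 < localFMPL X j A ∧ Real.log (localFMPL X j A) =
      -(((n : ℝ) - 1) / 2) * Real.log Real.pi - 1 / 2 * Real.log n
        - ((n : ℝ) - 1) / 2 * Real.log n + logScore n T j A := by
  have hn' : (0 : ℝ) < n := by exact_mod_cast hn
  have hr := residualVar_pos hT j A
  have e : principalMinor (scatterMatrix X) (insert j A) / principalMinor (scatterMatrix X) A
      = n * residualVar T j A := by
    rw [← residualVar_smul hn'.ne' T hj, hX, residualVar]
  have g1 : 0 < Real.Gamma (((n : ℝ) + A.card) / 2) := Real.Gamma_pos_of_pos (by positivity)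
  have g2 : 0 < Real.Gamma (((A.card : ℝ) + 1) / 2) := Real.Gamma_pos_of_pos (by positivity)
  have p1 : 0 < Real.pi ^ (-(((n : ℝ) - 1) / 2)) := Real.rpow_pos_of_pos Real.pi_pos _
  have p2 : 0 < (n : ℝ) ^ (-((2 * (A.card : ℝ) + 1) / 2)) := Real.rpow_pos_of_pos hn' _
  have hnr : 0 < n * residualVar T j A := mul_pos hn' hr
  have p3 : 0 < (n * residualVar T j A) ^ (-(((n : ℝ) - 1) / 2)) := Real.rpow_pos_of_pos hnr _
  unfold localFMPL
  rw [e]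
  refine ⟨by positivity, ?_⟩
  rw [Real.log_mul (by positivity) p3.ne', Real.log_mul (by positivity) p2.ne',
    Real.log_mul p1.ne' (by positivity), Real.log_div g1.ne' g2.ne', Real.log_rpow Real.pi_pos,
    Real.log_rpow hn', Real.log_rpow hnr, Real.log_mul hn'.ne' hr.ne', logScore]
  ring

theorem logScore_sub_ge {n : ℕ} (hn : 4 ≤ n) (hpn : p ≤ n) (T : Matrix (Fin p) (Fin p) ℝ)
    (j : Fin p) (A N : Finset (Fin p)) :
    ((A.card : ℝ) - N.card - ((A.card - N.card : ℕ) : ℝ) / 2) * Real.log n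
      - (Real.log (Real.Gamma (((N.card : ℝ) + 1) / 2))
          - Real.log (Real.Gamma (((A.card : ℝ) + 1) / 2)))
      + ((n : ℝ) - 1) / 2 * (Real.log (residualVar T j A) - Real.log (residualVar T j N))
      ≤ logScore n T j N - logScore n T j A := by
  have hA : A.card ≤ n := (A.card_le_univ.trans (by simp)).trans hpn
  have h := log_Gamma_add_div_two_sub_le (k := N.card) hn hA
  unfold logScore
  linarith

/-- Half-width of the entrywise confidence bounds for the normalised scatter matrix. -/
noncomputable def entryRadius (n : ℕ) : ℝ := √(√(Real.log n) / n)

theorem entryRadius_sq (n : ℕ) : entryRadius n ^ 2 = √(Real.log n) / n :=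
  Real.sq_sqrt (by positivity)

theorem tendsto_log_natCast_atTop : Tendsto (fun n : ℕ => Real.log n) atTop atTop :=
  Real.tendsto_log_atTop.comp tendsto_natCast_atTop_atTop

theorem tendsto_entryRadius : Tendsto entryRadius atTop (𝓝 0) := by
  have h : Tendsto (fun n : ℕ => √(Real.log n) / n) atTop (𝓝 0) := by
    have h1 : Tendsto (fun n : ℕ => Real.log n / n) atTop (𝓝 0) := by
      have := (Real.isLittleO_log_id_atTop.tendsto_div_nhds_zero).comp
        (tendsto_natCast_atTop_atTop (R := ℝ))
      exact this
    refine squeeze_zero' (Eventually.of_forall fun n => by positivity) ?_ h1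
    filter_upwards [tendsto_log_natCast_atTop.eventually_ge_atTop 1] with n hn
    gcongr
    rw [Real.sqrt_le_left (by linarith)]
    nlinarith
  have h' := (Real.continuous_sqrt.tendsto 0).comp h
  rw [Real.sqrt_zero] at h'
  exact h'

theorem exists_pos_forall_abs_sub_lt_mem {S : Matrix (Fin p) (Fin p) ℝ}
    {U : Set (Matrix (Fin p) (Fin p) ℝ)} (hU : U ∈ 𝓝 S) :
    ∃ ε > 0, ∀ T : Matrix (Fin p) (Fin p) ℝ, (∀ a b, |T a b - S a b| < ε) → T ∈ U := by
  obtain ⟨ε, hε, h⟩ := (Metric.mem_nhds_iff (α := Fin p → Fin p → ℝ)).1 hU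
  refine ⟨ε, hε, fun T hT => h ?_⟩
  exact (dist_pi_lt_iff hε).2 fun a => (dist_pi_lt_iff hε).2 fun b => hT a b

theorem eventually_forall_entryRadius {S : Matrix (Fin p) (Fin p) ℝ}
    {P : Matrix (Fin p) (Fin p) ℝ → Prop} (hP : ∀ᶠ T in 𝓝 S, P T) :
    ∀ᶠ n : ℕ in atTop, ∀ T : Matrix (Fin p) (Fin p) ℝ,
      (∀ a b, |T a b - S a b| ≤ entryRadius n) → P T := by
  obtain ⟨ε, hε, h⟩ := exists_pos_forall_abs_sub_lt_mem hP
  filter_upwards [tendsto_entryRadius.eventually_lt_const hε] with n hn T hT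
  exact h T fun a b => (hT a b).trans_lt hn

theorem eventually_lt_of_overfit (c K : ℝ) :
    ∀ᶠ n : ℕ in atTop, c + K * √(Real.log n) < 1 / 2 * Real.log n := by
  have h := Real.tendsto_sqrt_atTop.comp tendsto_log_natCast_atTop
  filter_upwards [h.eventually_ge_atTop 1, h.eventually_gt_atTop (2 * (|c| + |K|)),
    tendsto_log_natCast_atTop.eventually_ge_atTop 0] with n h1 h2 h3
  simp only [Function.comp_apply] at h1 h2
  have h4 := Real.mul_self_sqrt h3
  set s := √(Real.log n)
  nlinarith [le_abs_self c, le_abs_self K, abs_nonneg c, abs_nonneg K,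
    mul_le_mul_of_nonneg_right (le_abs_self K) (zero_le_one.trans h1),
    mul_le_mul_of_nonneg_left h1 (abs_nonneg c),
    mul_lt_mul_of_pos_right h2 (zero_lt_one.trans_le h1)]

theorem eventually_lt_of_underfit (c K : ℝ) {η : ℝ} (hη : 0 < η) :
    ∀ᶠ n : ℕ in atTop, c + K * Real.log n < ((n : ℝ) - 1) / 2 * η := by
  -- The extra `η / 2` absorbs the `-1` in `n - 1`.
  have h : Tendsto (fun n : ℕ => (c + η / 2 + K * Real.log n) / n) atTop (𝓝 0) := by
    have h1 : Tendsto (fun n : ℕ => Real.log n / n) atTop (𝓝 0) :=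
      (Real.isLittleO_log_id_atTop.tendsto_div_nhds_zero).comp
        (tendsto_natCast_atTop_atTop (R := ℝ))
    have h2 := (tendsto_const_div_atTop_nhds_zero_nat (c + η / 2)).add (h1.const_mul K)
    simp only [mul_zero, add_zero] at h2
    refine h2.congr fun n => ?_
    ring
  filter_upwards [h.eventually_lt_const (half_pos hη), eventually_gt_atTop 0] with n h1 h2
  have h2' : (0 : ℝ) < n := by exact_mod_cast h2
  rw [div_lt_iff₀ h2'] at h1
  linarith

/-- The threshold on `n` is uniform over all `T` in the box, so randomness enters only through
membership in it. -/
theorem eventually_logScore_lt {Ω : Matrix (Fin p) (Fin p) ℝ} (hΩ : Ω.PosDef) {j : Fin p}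
    {A : Finset (Fin p)} (hj : j ∉ A)
    (hne : A ≠ ({i | i ≠ j ∧ Ω i j ≠ 0} : Finset (Fin p))) :
    ∀ᶠ n : ℕ in atTop, ∀ T : Matrix (Fin p) (Fin p) ℝ, T.IsHermitian →
      (∀ a b, |T a b - Ω⁻¹ a b| ≤ entryRadius n) →
      logScore n T j A < logScore n T j {i | i ≠ j ∧ Ω i j ≠ 0} := by
  set N : Finset (Fin p) := {i | i ≠ j ∧ Ω i j ≠ 0} with hN
  set g := Real.log (Real.Gamma (((N.card : ℝ) + 1) / 2))
    - Real.log (Real.Gamma (((A.card : ℝ) + 1) / 2)) with hg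
  by_cases hsub : N ⊆ A
  · obtain ⟨K, δ₀, hδ₀, hK⟩ := exists_residualVar_sub_le hΩ j
    have hcard : N.card < A.card := Finset.card_lt_card (hsub.ssubset_of_ne hne.symm)
    have hρ : 0 < residualVar Ω⁻¹ j A / 2 := half_pos (residualVar_pos hΩ.inv j A)
    -- Half the population value bounds the denominator from below when `log x ≤ x - 1` is applied
    -- to the ratio.
    set ρ := residualVar Ω⁻¹ j A / 2 with hρdef
    have hr : ∀ᶠ T in 𝓝 Ω⁻¹, ρ < residualVar T j A :=
      (tendsto_residualVar hΩ.inv j A).eventually_const_lt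
        (by rw [hρdef]; linarith [residualVar_pos hΩ.inv j A])
    filter_upwards [eventually_forall_entryRadius hr, tendsto_entryRadius.eventually_le_const hδ₀,
      eventually_lt_of_overfit g (|K| / ρ), eventually_ge_atTop 4, eventually_ge_atTop p]
      with n h1 h2 h3 hn hpn T hT hTδ
    have hn' : (4 : ℝ) ≤ n := by exact_mod_cast hn
    obtain ⟨hTpd, hdiff⟩ := hK _ h2 T hT hTδ
    have hdiff := hdiff A hj hsub
    rw [entryRadius_sq] at hdiff
    have hrA := h1 T hTδ
    have hrN := residualVar_pos hTpd j N
    have hrA0 := hρ.trans hrA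
    have hlog : Real.log (residualVar T j N) - Real.log (residualVar T j A)
        ≤ |K| / ρ * (√(Real.log n) / n) := by
      rw [← Real.log_div hrN.ne' hrA0.ne']
      calc Real.log (residualVar T j N / residualVar T j A)
          ≤ residualVar T j N / residualVar T j A - 1 := Real.log_le_sub_one_of_pos (by positivity)
        _ = (residualVar T j N - residualVar T j A) / residualVar T j A := by
          field_simp
        _ ≤ |K| * (√(Real.log n) / n) / ρ := by
          refine div_le_div₀ (by positivity) (hdiff.trans ?_) hρ hrA.le
          exact mul_le_mul_of_nonneg_right (le_abs_self K) (by positivity)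
        _ = _ := by ring
    have hpen : ((n : ℝ) - 1) / 2 * (Real.log (residualVar T j N)
        - Real.log (residualVar T j A)) ≤ |K| / ρ * √(Real.log n) := by
      calc _ ≤ ((n : ℝ) - 1) / 2 * (|K| / ρ * (√(Real.log n) / n)) :=
            mul_le_mul_of_nonneg_left hlog (by linarith)
        _ ≤ n * (|K| / ρ * (√(Real.log n) / n)) :=
            mul_le_mul_of_nonneg_right (by linarith) (by positivity)
        _ = _ := by field_simp
    have hmain := logScore_sub_ge hn hpn T j A N
    rw [Nat.cast_sub hcard.le] at hmain
    have hc1 : (1 : ℝ) ≤ (A.card : ℝ) - N.card := by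
      have : (N.card : ℝ) + 1 ≤ A.card := by exact_mod_cast hcard
      linarith
    have hlogn : 0 ≤ Real.log n := Real.log_nonneg (by linarith)
    nlinarith [mul_le_mul_of_nonneg_right hc1 hlogn]
  · have hlt := residualVar_inv_lt hΩ hj hsub
    have hNp := residualVar_pos hΩ.inv j N
    have hη : 0 < (Real.log (residualVar Ω⁻¹ j A) - Real.log (residualVar Ω⁻¹ j N)) / 2 :=
      half_pos (sub_pos.2 (Real.log_lt_log hNp hlt))
    have hr : ∀ᶠ T in 𝓝 Ω⁻¹,
        (Real.log (residualVar Ω⁻¹ j A) - Real.log (residualVar Ω⁻¹ j N)) / 2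
          < Real.log (residualVar T j A) - Real.log (residualVar T j N) :=
      (((tendsto_residualVar hΩ.inv j A).log (residualVar_pos hΩ.inv j A).ne').sub
        ((tendsto_residualVar hΩ.inv j N).log hNp.ne')).eventually_const_lt (by linarith)
    set η := (Real.log (residualVar Ω⁻¹ j A) - Real.log (residualVar Ω⁻¹ j N)) / 2
    filter_upwards [eventually_forall_entryRadius hr,
      eventually_lt_of_underfit g ((A.card : ℝ) + N.card) hη, eventually_ge_atTop 4,
      eventually_ge_atTop p] with n h1 h2 hn hpn T hT hTδ
    have hn' : (4 : ℝ) ≤ n := by exact_mod_cast hn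
    have hmain := logScore_sub_ge hn hpn T j A N
    have hlogn : 0 ≤ Real.log n := Real.log_nonneg (by linarith)
    have h3 := mul_le_mul_of_nonneg_left (h1 T hTδ).le
      (show 0 ≤ ((n : ℝ) - 1) / 2 by linarith)
    have h4 : ((A.card - N.card : ℕ) : ℝ) ≤ A.card := by exact_mod_cast Nat.sub_le _ _
    -- The penalty may favour the smaller `A`; a crude `O(log n)` bound is enough against a linear
    -- gain.
    have h5 : -((A.card : ℝ) + N.card) * Real.log n
        ≤ ((A.card : ℝ) - N.card - ((A.card - N.card : ℕ) : ℝ) / 2) * Real.log n :=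
      mul_le_mul_of_nonneg_right
        (by linarith [A.card.cast_nonneg (α := ℝ)]) hlogn
    linarith

theorem scatterMatrix_isHermitian {n : ℕ} (X : Matrix (Fin n) (Fin p) ℝ) :
    (scatterMatrix X).IsHermitian := by
  simpa [scatterMatrix] using Matrix.isHermitian_conjTranspose_mul_self X

theorem eventually_argmaxLocalFMPL_eq {Ω : Matrix (Fin p) (Fin p) ℝ} (hΩ : Ω.PosDef)
    (j : Fin p) :
    ∀ᶠ n : ℕ in atTop, ∀ X : Matrix (Fin n) (Fin p) ℝ,
      (∀ a b, |(n : ℝ)⁻¹ * scatterMatrix X a b - Ω⁻¹ a b| ≤ entryRadius n) →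
      argmaxLocalFMPL X j = {({i | i ≠ j ∧ Ω i j ≠ 0} : Finset (Fin p))} := by
  set N : Finset (Fin p) := {i | i ≠ j ∧ Ω i j ≠ 0} with hN
  have hjN : j ∉ N := by simp [hN]
  have hall : ∀ᶠ n : ℕ in atTop, ∀ A : Finset (Fin p), j ∉ A → A ≠ N →
      ∀ T : Matrix (Fin p) (Fin p) ℝ, T.IsHermitian →
      (∀ a b, |T a b - Ω⁻¹ a b| ≤ entryRadius n) → logScore n T j A < logScore n T j N := by
    -- There are finitely many `A`, so one threshold serves them all.
    refine eventually_all.2 fun A => ?_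
    by_cases hA : j ∉ A ∧ A ≠ N
    · filter_upwards [eventually_logScore_lt hΩ hA.1 hA.2] with n hn _ _ using hn
    · exact Eventually.of_forall fun n h1 h2 => absurd ⟨h1, h2⟩ hA
  obtain ⟨K, δ₀, hδ₀, hK⟩ := exists_residualVar_sub_le hΩ j
  filter_upwards [hall, tendsto_entryRadius.eventually_le_const hδ₀, eventually_gt_atTop 0]
    with n h1 h2 hn X hX
  have hn' : (n : ℝ) ≠ 0 := by exact_mod_cast hn.ne'
  set T : Matrix (Fin p) (Fin p) ℝ := (n : ℝ)⁻¹ • scatterMatrix X with hT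
  have hTh : T.IsHermitian := by
    have := (scatterMatrix_isHermitian X).eq
    rw [hT, Matrix.IsHermitian, Matrix.conjTranspose_smul, this, star_trivial]
  have hTpd : T.PosDef := (hK _ h2 T hTh hX).1
  have hXT : scatterMatrix X = (n : ℝ) • T := by rw [hT, smul_smul, mul_inv_cancel₀ hn', one_smul]
  have hlt : ∀ A : Finset (Fin p), j ∉ A → A ≠ N → localFMPL X j A < localFMPL X j N := by
    intro A hA hne
    obtain ⟨q1, q2⟩ := localFMPL_pos hn X hTpd hXT hA
    obtain ⟨q3, q4⟩ := localFMPL_pos hn X hTpd hXT hjN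
    rw [← Real.log_lt_log_iff q1 q3, q2, q4]
    exact add_lt_add_right (h1 A hA hne T hTh hX) _
  ext A
  simp only [argmaxLocalFMPL, Set.mem_ofPred_eq, Set.mem_singleton_iff]
  constructor
  · rintro ⟨hA, hmax⟩
    by_contra hne
    exact (hlt A hA hne).not_ge (hmax N hjN)
  · intro hA
    rw [hA]
    refine ⟨hjN, fun B hB => ?_⟩
    rcases eq_or_ne B N with rfl | hne
    · exact le_rfl
    · exact (hlt B hB hne).le

end Score

/-! ### Concentration of the scatter matrix -/

section Concentration

variable {p : ℕ}

/-- Gaussian coordinates have fourth moments, and Hölder with exponents 4 and 4 gives the finite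
variance that Chebyshev needs. -/
theorem memLp_two_mul_coord (μ : Measure (EuclideanSpace ℝ (Fin p))) [IsGaussian μ] (a b : Fin p) :
    MemLp (fun x : EuclideanSpace ℝ (Fin p) => x a * x b) 2 μ := by
  have h : ∀ k : Fin p, MemLp (fun x : EuclideanSpace ℝ (Fin p) => x k) 4 μ := fun k =>
    ((IsGaussian.hasGaussianLaw_id (μ := μ)).map (EuclideanSpace.proj k)).memLp (by simp)
  have : ENNReal.HolderTriple 4 4 2 := ⟨by
    rw [← two_mul, show (4 : ENNReal) = 2 * 2 by norm_num,
      ENNReal.mul_inv (by simp) (by simp), ← mul_assoc, ENNReal.mul_inv_cancel (by simp) (by simp),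
      one_mul]⟩
  exact (h b).mul (h a)

theorem integral_mul_coord_multivariateGaussian {S : Matrix (Fin p) (Fin p) ℝ}
    (hS : S.PosSemidef) (a b : Fin p) :
    ∫ x, x a * x b ∂(multivariateGaussian 0 S) = S a b := by
  have hm : ∀ k : Fin p,
      MemLp (fun x : EuclideanSpace ℝ (Fin p) => x k) 2 (multivariateGaussian 0 S) :=
    fun k => ((IsGaussian.hasGaussianLaw_id (μ := multivariateGaussian 0 S)).map
      (EuclideanSpace.proj k)).memLp_two
  have h0 : ∀ k : Fin p, ∫ x, x k ∂(multivariateGaussian 0 S) = 0 := by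
    intro k
    have := IsGaussian.integral_dual (μ := multivariateGaussian 0 S) (EuclideanSpace.proj k)
    simpa using this
  have h := covariance_eq_sub (hm a) (hm b)
  rw [covariance_eval_multivariateGaussian hS, h0, h0] at h
  simpa using h.symm

/-- Chebyshev's inequality for the mean of a sample. -/
theorem meas_lt_abs_sampleMean_sub_le {𝓧 E : Type*} [MeasurableSpace 𝓧] [MeasurableSpace E]
    {P : Measure 𝓧} [IsProbabilityMeasure P] {μ : Measure E} {n : ℕ} (hn : 0 < n)
    {X : Fin n → 𝓧 → E} (hindep : iIndepFun X P) (hlaw : ∀ i, HasLaw (X i) μ P)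
    {q : E → ℝ} (hqm : Measurable q) (hq : MemLp q 2 μ) {δ : ℝ} (hδ : 0 < δ) :
    P {ω | δ < |(n : ℝ)⁻¹ * ∑ i, q (X i ω) - ∫ x, q x ∂μ|}
      ≤ ENNReal.ofReal (Var[q; μ] / (n * δ ^ 2)) := by
  have hn' : (0 : ℝ) < n := by exact_mod_cast hn
  have hmem : ∀ i, MemLp (q ∘ X i) 2 P := fun i =>
    MemLp.comp_of_map (by rwa [(hlaw i).map_eq]) (hlaw i).aemeasurable
  have hvar : ∀ i, Var[q ∘ X i; P] = Var[q; μ] := by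
    intro i
    rw [← (hlaw i).map_eq, variance_map hqm.aemeasurable (hlaw i).aemeasurable]
  have hmean : ∀ i, ∫ ω, q (X i ω) ∂P = ∫ x, q x ∂μ := fun i =>
    (hlaw i).integral_comp hqm.aestronglyMeasurable
  have hsum := IndepFun.variance_sum (μ := P) (s := Finset.univ) (X := fun i => q ∘ X i)
    (fun i _ => hmem i)
    (fun i _ k _ hik => (hindep.indepFun hik).comp hqm hqm)
  simp only [hvar, Finset.sum_const, Finset.card_univ, Fintype.card_fin, nsmul_eq_mul] at hsum
  have hmemS : MemLp (∑ i, q ∘ X i) 2 P := memLp_finsetSum' _ fun i _ => hmem i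
  have hint : ∫ ω, (∑ i, q ∘ X i) ω ∂P = n * ∫ x, q x ∂μ := by
    simp only [Finset.sum_apply, Function.comp_apply]
    have hi : ∀ i, Integrable (fun ω => q (X i ω)) P := fun i => (hmem i).integrable (by norm_num)
    rw [integral_finsetSum _ fun i _ => hi i]
    simp only [hmean, Finset.sum_const, Finset.card_univ, Fintype.card_fin, nsmul_eq_mul]
  have hcheb := meas_ge_le_variance_div_sq hmemS (c := n * δ) (by positivity)
  rw [hsum, hint] at hcheb
  refine (measure_mono fun ω hω => ?_).trans (hcheb.trans_eq ?_)
  · simp only [Set.mem_ofPred_eq, Finset.sum_apply, Function.comp_apply] at hω ⊢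
    have e : ∑ i, q (X i ω) - n * ∫ x, q x ∂μ
        = n * ((n : ℝ)⁻¹ * ∑ i, q (X i ω) - ∫ x, q x ∂μ) := by field_simp
    rw [e, abs_mul, abs_of_pos hn']
    exact mul_le_mul_of_nonneg_left hω.le hn'.le
  · congr 1
    field_simp

theorem tendsto_measure_entryRadius_lt {S : Matrix (Fin p) (Fin p) ℝ} (hS : S.PosSemidef)
    {𝓧 : ℕ → Type*} [∀ n, MeasurableSpace (𝓧 n)]
    (P : ∀ n, Measure (𝓧 n)) [∀ n, IsProbabilityMeasure (P n)]
    (X : ∀ n, Fin n → 𝓧 n → EuclideanSpace ℝ (Fin p)) (hindep : ∀ n, iIndepFun (X n) (P n))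
    (hlaw : ∀ n i, HasLaw (X n i) (multivariateGaussian 0 S) (P n)) (a b : Fin p) :
    Tendsto (fun n : ℕ => P n {ω | entryRadius n <
      |(n : ℝ)⁻¹ * scatterMatrix (Matrix.of fun i k => X n i ω k) a b - S a b|})
      atTop (𝓝 0) := by
  set V := Var[fun x : EuclideanSpace ℝ (Fin p) => x a * x b; multivariateGaussian 0 S]
  have hlim : Tendsto (fun n : ℕ => ENNReal.ofReal (V / √(Real.log n))) atTop (𝓝 0) := by
    have h := (Real.tendsto_sqrt_atTop.comp tendsto_log_natCast_atTop).const_div_atTop V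
    simpa using ENNReal.tendsto_ofReal h
  refine tendsto_of_tendsto_of_tendsto_of_le_of_le' tendsto_const_nhds hlim
    (Eventually.of_forall fun _ => zero_le) ?_
  filter_upwards [eventually_ge_atTop 2] with n hn
  have hn' : (2 : ℝ) ≤ n := by exact_mod_cast hn
  have hlog : 0 < Real.log n := Real.log_pos (by linarith)
  have hδ : 0 < entryRadius n := by unfold entryRadius; positivity
  have h := meas_lt_abs_sampleMean_sub_le (by lia) (hindep n) (hlaw n)
    (q := fun x => x a * x b) (by fun_prop) (memLp_two_mul_coord _ a b) hδ
  rw [integral_mul_coord_multivariateGaussian hS, entryRadius_sq] at h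
  have e : (n : ℝ) * (√(Real.log n) / n) = √(Real.log n) := by field_simp
  rw [e] at h
  simpa [scatterMatrix, Matrix.mul_apply] using h

/-- If finitely many exceptional events have probability tending to `0`, and eventually an event
contains the complement of their union, then its probability tends to `1`. -/
theorem tendsto_measure_one_of_forall_tendsto_zero {ι : Type*} [Finite ι] {𝓧 : ℕ → Type*}
    [∀ n, MeasurableSpace (𝓧 n)] (P : ∀ n, Measure (𝓧 n)) [∀ n, IsProbabilityMeasure (P n)]
    {B : ι → ∀ n, Set (𝓧 n)} {G : ∀ n, Set (𝓧 n)}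
    (hB : ∀ i, Tendsto (fun n => P n (B i n)) atTop (𝓝 0))
    (hG : ∀ᶠ n in atTop, ∀ ω, (∀ i, ω ∉ B i n) → ω ∈ G n) :
    Tendsto (fun n => P n (G n)) atTop (𝓝 1) := by
  have := Fintype.ofFinite ι
  have hsum : Tendsto (fun n => 1 - ∑ i, P n (B i n)) atTop (𝓝 1) := by
    have h := tendsto_finsetSum Finset.univ fun i _ => hB i
    simpa using ENNReal.Tendsto.sub tendsto_const_nhds h (Or.inl ENNReal.one_ne_top)
  refine tendsto_of_tendsto_of_tendsto_of_le_of_le' hsum tendsto_const_nhds ?_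
    (Eventually.of_forall fun n => prob_le_one)
  filter_upwards [hG] with n hn
  rw [tsub_le_iff_right]
  -- Subadditivity in place of complements avoids any measurability of the events.
  calc (1 : ENNReal) = P n Set.univ := measure_univ.symm
    _ ≤ P n (G n ∪ ⋃ i, B i n) := measure_mono fun ω _ => by
        by_cases h : ∃ i, ω ∈ B i n
        · exact Or.inr (Set.mem_iUnion.2 h)
        · exact Or.inl (hn ω (not_exists.1 h))
    _ ≤ P n (G n) + P n (⋃ i, B i n) := measure_union_le _ _
    _ ≤ P n (G n) + ∑ i, P n (B i n) := by
        gcongr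
        exact measure_iUnion_fintype_le _ _

end Concentration

theorem theorem2 {p : ℕ}
    (Ωstar : Matrix (Fin p) (Fin p) ℝ) (hΩ : Ωstar.PosDef)
    -- for every n, a random sample of size n, on a probability space that may depend on n
    {𝓧 : ℕ → Type*} [∀ n, MeasurableSpace (𝓧 n)]
    (P : ∀ n, Measure (𝓧 n)) [∀ n, IsProbabilityMeasure (P n)]
    (X : ∀ n, Fin n → 𝓧 n → EuclideanSpace ℝ (Fin p))
    (hindep : ∀ n, iIndepFun (X n) (P n))
    (hlaw : ∀ n i, HasLaw (X n i) (multivariateGaussian 0 Ωstar⁻¹) (P n)) :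
    ∀ j : Fin p,
      Tendsto
        (fun n : ℕ => P n {ω | argmaxLocalFMPL (Matrix.of fun i k => X n i ω k) j
          = {markovBlanket (condIndepGraph (multivariateGaussian 0 Ωstar⁻¹)) j}})
        atTop (𝓝 1) := by
  intro j
  refine tendsto_measure_one_of_forall_tendsto_zero P
    (fun s : Fin p × Fin p => tendsto_measure_entryRadius_lt hΩ.inv.posSemidef P X hindep hlaw
      s.1 s.2) ?_
  filter_upwards [eventually_argmaxLocalFMPL_eq hΩ j] with n hn ω hω
  rw [markovBlanket_condIndepGraph_multivariateGaussian hΩ j]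
  exact hn _ fun a b => not_lt.1 (hω (a, b))
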